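/- Let $M$ be a metric space with a base point $0\in M$. Let $\mathrm{Lip}_0(M)$ be the Banach space of Lipschitz functions $f:M\to\mathbb R$ with $f(0)=0$, with the norm $\|f\|_L=\sup_{x\ne y}|f(x)-f(y)|/d(x,y)$. For $x\in M$ let $\delta(x)\in\mathrm{Lip}_0(M)^*$ be the evaluation $f\mapsto f(x)$, and let the Lipschitz-free space $\mathcal F(M)$ be the norm-closed linear span of $\{\delta(x):x\in M\}$ in $\mathrm{Lip}_0(M)^*$. The weak$^*$ topology of $\mathrm{Lip}_0(M)$ is the one that it carries as the dual of $\mathcal F(M)$, under the pairing $\langle m,f\rangle=m(f)$. A Lipschitz map $f:M\to\mathbb R$ is called curve-flat if for every compact $K\subset\mathbb R$ and every Lipschitz map $\gamma:K\to M$, $$\lim_{\substack{y\to x\\ y\in K}}\frac{|f(\gamma(x))-f(\gamma(y))|}{|x-y|}=0\quad\text{for Lebesgue-almost every }x\in K$$ (no condition being imposed at isolated points $x$ of $K$). Let $\mathrm{CF}_0(M)$ be the set of curve-flat $f\in\mathrm{Lip}_0(M)$. Call $M$ purely 1-unrectifiable if $\mathcal H^1(\gamma(A))=0$ for every Borel set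 $A\subset\mathbb R$ and every Lipschitz map $\gamma:A\to M$, where $\mathcal H^1$ is the Hausdorff 1-measure. Then: 1. $\mathrm{CF}_0(M)$ is weak$^*$-closed in $\mathrm{Lip}_0(M)$. 2. If $\mathrm{CF}_0(M)$ is weak$^*$-dense in $\mathrm{Lip}_0(M)$, then $M$ is purely 1-unrectifiable. 3. If $\mathrm{CF}_0(M)$ is weak$^*$-dense in $\mathrm{Lip}_0(M)$ and $M$ is complete, then moreover $\mathcal H^1(\gamma(A))=0$ for every set $A\subset\mathbb R$ (Borel or not) and every Lipschitz map $\gamma:A\to M$. -/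

import Mathlib

open Set Filter Topology MeasureTheory
open scoped NNReal

noncomputable section

/-- The real Lipschitz functions on `M` vanishing at the base point `o`, as a subspace of the
space of all real functions. -/
def lipZeroSubmodule {M : Type*} [MetricSpace M] (o : M) : Submodule ℝ (M → ℝ) where
  carrier := {f | f o = 0 ∧ ∃ C : ℝ≥0, LipschitzWith C f}
  add_mem' := by
    rintro f g ⟨hf, C, hC⟩ ⟨hg, D, hD⟩
    exact ⟨by simp [hf, hg], C + D, hC.add hD⟩
  zero_mem' := ⟨rfl, 0, LipschitzWith.const 0⟩
  smul_mem' := by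
    rintro c f ⟨hf, C, hC⟩
    refine ⟨by simp [hf], ‖c‖₊ * C, LipschitzWith.of_dist_le_mul fun x y => ?_⟩
    have h := hC.dist_le_mul x y
    rw [Real.dist_eq] at h ⊢
    simp only [Pi.smul_apply, smul_eq_mul, NNReal.coe_mul, coe_nnnorm, Real.norm_eq_abs]
    rw [← mul_sub, abs_mul, mul_assoc]
    exact mul_le_mul_of_nonneg_left h (abs_nonneg c)

/-- The space `Lip₀(M)` of the pointed metric space `(M, o)`. It is a separate type, so that it
carries the Lipschitz norm and not the topology of pointwise convergence. -/
def LipZero {M : Type*} [MetricSpace M] (o : M) : Type _ := lipZeroSubmodule o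

namespace LipZero

variable {M : Type*} [MetricSpace M] {o : M}

instance : AddCommGroup (LipZero o) := inferInstanceAs (AddCommGroup (lipZeroSubmodule o))

instance : Module ℝ (LipZero o) := inferInstanceAs (Module ℝ (lipZeroSubmodule o))

instance : CoeFun (LipZero o) (fun _ => M → ℝ) := ⟨Subtype.val⟩

@[simp] theorem add_apply (f g : LipZero o) (x : M) : (f + g) x = f x + g x := rfl

@[simp] theorem neg_apply (f : LipZero o) (x : M) : (-f) x = -f x := rfl

@[simp] theorem zero_apply (x : M) : (0 : LipZero o) x = 0 := rfl

@[simp] theorem smul_apply (c : ℝ) (f : LipZero o) (x : M) : (c • f) x = c * f x := rfl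

@[simp] theorem base_apply (f : LipZero o) : f o = 0 := f.2.1

/-- The Lipschitz norm `sup_{x ≠ y} |f x - f y| / d(x, y)`; the pairs with `x = y` contribute
the value `0 / 0 = 0`. -/
instance : Norm (LipZero o) := ⟨fun f => ⨆ p : M × M, |f p.1 - f p.2| / dist p.1 p.2⟩

theorem norm_def (f : LipZero o) :
    ‖f‖ = ⨆ p : M × M, |f p.1 - f p.2| / dist p.1 p.2 := rfl

theorem bddAbove_slopes (f : LipZero o) :
    BddAbove (range fun p : M × M => |f p.1 - f p.2| / dist p.1 p.2) := by
  obtain ⟨C, hC⟩ := f.2.2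
  refine ⟨C, ?_⟩
  rintro _ ⟨p, rfl⟩
  have h := hC.dist_le_mul p.1 p.2
  rw [Real.dist_eq] at h
  exact div_le_of_le_mul₀ dist_nonneg C.2 h

theorem norm_nonneg' (f : LipZero o) : 0 ≤ ‖f‖ :=
  Real.iSup_nonneg fun _ => div_nonneg (abs_nonneg _) dist_nonneg

theorem abs_sub_le (f : LipZero o) (x y : M) : |f x - f y| ≤ ‖f‖ * dist x y := by
  rcases eq_or_ne x y with rfl | h
  · simp
  · have h1 := le_ciSup (bddAbove_slopes f) (x, y)
    exact (div_le_iff₀ (dist_pos.2 h)).1 h1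

theorem norm_le_of_forall (f : LipZero o) {C : ℝ} (hC : 0 ≤ C)
    (h : ∀ x y, |f x - f y| ≤ C * dist x y) : ‖f‖ ≤ C :=
  Real.iSup_le (fun p => div_le_of_le_mul₀ dist_nonneg hC (h p.1 p.2)) hC

theorem norm_smul_le' (c : ℝ) (f : LipZero o) : ‖c • f‖ ≤ ‖c‖ * ‖f‖ := by
  refine norm_le_of_forall _ (mul_nonneg (norm_nonneg c) (norm_nonneg' f)) fun x y => ?_
  rw [smul_apply, smul_apply, ← mul_sub, abs_mul, mul_assoc]
  exact mul_le_mul_of_nonneg_left (abs_sub_le f x y) (abs_nonneg c)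

instance : NormedAddCommGroup (LipZero o) :=
  AddGroupNorm.toNormedAddCommGroup
    { toFun := fun f => ‖f‖
      map_zero' :=
        le_antisymm (norm_le_of_forall _ le_rfl fun x y => by simp) (norm_nonneg' _)
      add_le' := fun f g => by
        refine norm_le_of_forall _ (add_nonneg (norm_nonneg' f) (norm_nonneg' g)) fun x y => ?_
        have h1 := abs_sub_le f x y
        have h2 := abs_sub_le g x y
        have h3 := abs_add_le (f x - f y) (g x - g y)
        have h4 : (f + g) x - (f + g) y = (f x - f y) + (g x - g y) := by
          simp only [add_apply]; ring
        rw [h4, add_mul]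
        linarith
      neg' := fun f => by
        simp only [norm_def, neg_apply]
        congr 1
        funext p
        rw [← abs_neg]
        congr 2
        ring
      eq_zero_of_map_eq_zero' := fun f hf => by
        apply Subtype.ext
        funext x
        have h := abs_sub_le f x o
        rw [show ‖f‖ = 0 from hf, zero_mul, base_apply, sub_zero] at h
        exact abs_nonpos_iff.1 h }

instance : NormedSpace ℝ (LipZero o) where
  norm_smul_le := norm_smul_le'

/-- The evaluation functional `δ(x) ∈ Lip₀(M)*`, `⟨δ(x), f⟩ = f(x)`. -/
def delta (o x : M) : StrongDual ℝ (LipZero o) :=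
  LinearMap.mkContinuous
    { toFun := fun f => f x
      map_add' := fun _ _ => rfl
      map_smul' := fun _ _ => rfl }
    (dist x o)
    (fun f => by
      have h := abs_sub_le f x o
      rw [base_apply, sub_zero, mul_comm] at h
      exact h)

end LipZero

/-- The Lipschitz-free space `F(M)`: the norm-closed linear span of the evaluation functionals
in `Lip₀(M)*`. -/
def lipschitzFree {M : Type*} [MetricSpace M] (o : M) : Submodule ℝ (StrongDual ℝ (LipZero o)) :=
  (Submodule.span ℝ (range (LipZero.delta o))).topologicalClosure

/-- The canonical map `Lip₀(M) → F(M)*`, `f ↦ (m ↦ ⟨m, f⟩)`, with values in `F(M)*` equipped with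
its weak* topology. -/
def LipZero.toWeakDual {M : Type*} [MetricSpace M] {o : M} (f : LipZero o) :
    WeakDual ℝ (lipschitzFree o) :=
  StrongDual.toWeakDual
    ((NormedSpace.inclusionInDoubleDual ℝ (LipZero o) f).comp (lipschitzFree o).subtypeL)

/-- The weak* topology of `Lip₀(M)`, as the dual space of `F(M)`. -/
@[reducible] def weakStarTopology {M : Type*} [MetricSpace M] (o : M) : TopologicalSpace (LipZero o) :=
  TopologicalSpace.induced LipZero.toWeakDual inferInstance

/-- A Lipschitz map `f : M → N` is curve-flat if, for every compact `K ⊆ ℝ` and every Lipschitz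
`γ : K → M`, the quotient `d(f(γ(x)), f(γ(y))) / |x - y|` tends to `0` as `y → x` in `K`, for
Lebesgue-almost every `x ∈ K`. (Maps on `K` are given as restrictions of functions on `ℝ`.) -/
def IsCurveFlat {M N : Type*} [MetricSpace M] [MetricSpace N] (f : M → N) : Prop :=
  (∃ L : ℝ≥0, LipschitzWith L f) ∧
    ∀ (K : Set ℝ) (γ : ℝ → M), IsCompact K → (∃ C : ℝ≥0, LipschitzOnWith C γ K) →
      ∀ᵐ x ∂(volume : Measure ℝ), x ∈ K →
        Tendsto (fun y => dist (f (γ x)) (f (γ y)) / |x - y|) (𝓝[K \ {x}] x) (𝓝 0)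

/-- The set `CF₀(M)` of real-valued curve-flat functions vanishing at the base point. -/
def curveFlatZero {M : Type*} [MetricSpace M] (o : M) : Set (LipZero o) :=
  {f | IsCurveFlat (f : M → ℝ)}

/-- `M` is purely 1-unrectifiable: Lipschitz images in `M` of Borel subsets of the line are null
for the Hausdorff 1-measure. -/
def IsPurelyOneUnrectifiable (M : Type*) [MetricSpace M] [MeasurableSpace M] [BorelSpace M] :
    Prop :=
  ∀ (A : Set ℝ) (γ : ℝ → M), MeasurableSet A → (∃ C : ℝ≥0, LipschitzOnWith C γ A) →
    μH[1] (γ '' A) = 0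

/-- The same, for Lipschitz images of arbitrary (possibly nonmeasurable) subsets of the line. -/
def IsStronglyPurelyOneUnrectifiable (M : Type*) [MetricSpace M] [MeasurableSpace M]
    [BorelSpace M] : Prop :=
  ∀ (A : Set ℝ) (γ : ℝ → M), (∃ C : ℝ≥0, LipschitzOnWith C γ A) → μH[1] (γ '' A) = 0

end

/-! For compact `K` and Lipschitz `γ` on `K`, the functional sending `f` to the integral over `K` of
`(f ∘ γ)'` lies in `F(M)`: it is a norm limit of finite sums of differences `δ(γ b) - δ(γ a)` with
`a, b ∈ K`. A Lipschitz `f` is curve-flat exactly when all these functionals vanish on it, so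
`CF₀(M)` is an intersection of kernels of weak* continuous functionals, hence closed.

If `CF₀(M)` is also dense, every Lipschitz function is curve-flat, in particular the distance to `γ
x`. Integrating its derivative along `γ` bounds `dist (γ x) (γ y)` by `C` times the length of the
gaps of `K` in `[x, y]`. The gaps in fine covers of `K` have small total length, so `γ '' K` is
`μH[1]`-null. Inner regularity passes from compact to Borel sets, and completeness from Borel to
arbitrary ones. -/

/-! ### Covers of compact subsets of the line -/

/-- Cut the line into cells of length `δ` and shrink each cell meeting `K` to the hull of its part
of `K`. The hulls stay in the `δ`-thickening of `K`, whose measure tends to that of `K`. Half-open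
intervals give disjointness; closed ones are needed to cover `K`. -/
theorem IsCompact.exists_finset_Icc_cover {K : Set ℝ} (hK : IsCompact K) {ε : ℝ} (hε : 0 < ε) :
    ∃ (S : Finset ℤ) (a b : ℤ → ℝ),
      (∀ k ∈ S, a k ∈ K ∧ b k ∈ K ∧ a k ≤ b k ∧ b k - a k ≤ ε) ∧
      (S : Set ℤ).PairwiseDisjoint (fun k => Ioc (a k) (b k)) ∧
      K ⊆ ⋃ k ∈ S, Icc (a k) (b k) ∧
      volume ((⋃ k ∈ S, Ioc (a k) (b k)) \ K) ≤ ENNReal.ofReal ε := by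
  have hfin : volume K ≠ ⊤ := hK.measure_lt_top.ne
  have hlim := tendsto_measure_cthickening_of_isCompact (μ := (volume : Measure ℝ)) hK
  have hev : ∀ᶠ r in 𝓝 (0 : ℝ),
      volume (Metric.cthickening r K) < volume K + ENNReal.ofReal ε :=
    hlim.eventually_lt_const (ENNReal.lt_add_right hfin (by simpa using hε))
  obtain ⟨r, hr, hball⟩ := Metric.eventually_nhds_iff.1 hev
  obtain ⟨δ, hδ, hδε, hδr⟩ : ∃ δ : ℝ, 0 < δ ∧ δ ≤ ε ∧ δ < r :=
    ⟨min ε (r / 2), by positivity, min_le_left _ _, (min_le_right _ _).trans_lt (by linarith)⟩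
  have hvol : volume (Metric.cthickening δ K) ≤ volume K + ENNReal.ofReal ε :=
    (hball (by rwa [Real.dist_eq, sub_zero, abs_of_pos hδ])).le
  obtain ⟨p, hp⟩ := hK.bddBelow
  obtain ⟨q, hq⟩ := hK.bddAbove
  let c : ℤ → Set ℝ := fun k => K ∩ Icc (k * δ) ((k + 1) * δ)
  have hc : ∀ k, IsCompact (c k) := fun k => hK.inter_right isClosed_Icc
  classical
  let S : Finset ℤ := (Finset.Icc ⌊p / δ⌋ ⌊q / δ⌋).filter fun k => (c k).Nonempty
  have hne : ∀ k ∈ S, (c k).Nonempty := fun k hk => (Finset.mem_filter.1 hk).2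
  have ha : ∀ k ∈ S, sInf (c k) ∈ c k := fun k hk => (hc k).sInf_mem (hne k hk)
  have hb : ∀ k ∈ S, sSup (c k) ∈ c k := fun k hk => (hc k).sSup_mem (hne k hk)
  refine ⟨S, fun k => sInf (c k), fun k => sSup (c k), fun k hk => ⟨(ha k hk).1, (hb k hk).1,
    (csInf_le (hc k).bddBelow (ha k hk)).trans (le_csSup (hc k).bddAbove (ha k hk)), ?_⟩, ?_, ?_, ?_⟩
  · have h1 := (ha k hk).2.1
    have h2 := (hb k hk).2.2
    linarith
  · intro k hk l hl hkl
    wlog h : k < l generalizing k l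
    · exact (this hl hk hkl.symm (lt_of_le_of_ne (not_lt.1 h) hkl.symm)).symm
    refine Set.disjoint_left.2 fun x hx hx' => ?_
    have h1 := (hb k hk).2.2
    have h2 := (ha l hl).2.1
    have h3 : ((k : ℝ) + 1) ≤ l := by exact_mod_cast h
    have h4 := mul_le_mul_of_nonneg_right h3 hδ.le
    have := hx.2
    have := hx'.1
    linarith
  · intro x hx
    have hxc : x ∈ c ⌊x / δ⌋ := by
      refine ⟨hx, ?_, ?_⟩
      · exact (le_div_iff₀ hδ).1 (Int.floor_le _)
      · exact (div_le_iff₀ hδ).1 (Int.lt_floor_add_one _).le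
    refine mem_iUnion₂.2 ⟨⌊x / δ⌋, Finset.mem_filter.2 ⟨Finset.mem_Icc.2 ⟨?_, ?_⟩, ⟨x, hxc⟩⟩,
      csInf_le (hc _).bddBelow hxc, le_csSup (hc _).bddAbove hxc⟩
    · exact Int.floor_mono (div_le_div_of_nonneg_right (hp hx) hδ.le)
    · exact Int.floor_mono (div_le_div_of_nonneg_right (hq hx) hδ.le)
  · have hsub : (⋃ k ∈ S, Ioc (sInf (c k)) (sSup (c k))) ⊆ Metric.cthickening δ K := by
      refine iUnion₂_subset fun k hk x hx => ?_
      refine Metric.mem_cthickening_of_dist_le x (sInf (c k)) δ K (ha k hk).1 ?_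
      have h1 := (ha k hk).2.1
      have h2 := (hb k hk).2.2
      rw [Real.dist_eq, abs_of_pos (sub_pos.2 hx.1)]
      linarith [hx.2]
    calc _ ≤ volume (Metric.cthickening δ K \ K) := measure_mono (sdiff_subset_sdiff_left hsub)
      _ = volume (Metric.cthickening δ K) - volume K :=
        measure_sdiff (Metric.self_subset_cthickening K) hK.measurableSet.nullMeasurableSet hfin
      _ ≤ ENNReal.ofReal ε := tsub_le_iff_left.2 hvol

/-! ### Derivatives of Lipschitz functions on the line -/

theorem LipschitzWith.locallyIntegrable_deriv {F : ℝ → ℝ} {L : ℝ≥0} (hF : LipschitzWith L F) :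
    LocallyIntegrable (deriv F) := by
  refine (locallyIntegrable_const (L : ℝ)).mono (measurable_deriv F).aestronglyMeasurable ?_
  refine Eventually.of_forall fun x => ?_
  simpa using norm_deriv_le_of_lipschitz hF

theorem LipschitzWith.abs_setIntegral_deriv_le {F : ℝ → ℝ} {L : ℝ≥0} (hF : LipschitzWith L F)
    {s : Set ℝ} {ε : ℝ} (hε : 0 ≤ ε) (hs : volume s ≤ ENNReal.ofReal ε) :
    |∫ x in s, deriv F x| ≤ L * ε := by
  have h := norm_setIntegral_le_of_norm_le_const (μ := volume) (f := deriv F) (C := (L : ℝ))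
    (hs.trans_lt ENNReal.ofReal_lt_top) (fun x _ => norm_deriv_le_of_lipschitz hF)
  refine h.trans (mul_le_mul_of_nonneg_left ?_ L.2)
  exact ENNReal.toReal_le_of_le_ofReal hε hs

theorem LipschitzWith.setIntegral_Ioc_deriv {F : ℝ → ℝ} {L : ℝ≥0} (hF : LipschitzWith L F)
    {a b : ℝ} (hab : a ≤ b) : ∫ x in Ioc a b, deriv F x = F b - F a := by
  rw [← intervalIntegral.integral_of_le hab]
  exact (hF.lipschitzOnWith (s := uIcc a b)).absolutelyContinuousOnInterval.integral_deriv_eq_sub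

/-- By the fundamental theorem of calculus the sum is the integral of `F'` over the union of the
intervals. Up to finitely many left endpoints this union contains `K`, and on the excess `|F'| ≤ L`.
-/
theorem LipschitzWith.abs_sum_sub_setIntegral_deriv_le {F : ℝ → ℝ} {L : ℝ≥0}
    (hF : LipschitzWith L F) {K : Set ℝ} (hK : IsCompact K) {S : Finset ℤ} {a b : ℤ → ℝ} {ε : ℝ}
    (hε : 0 ≤ ε) (hab : ∀ k ∈ S, a k ≤ b k)
    (hdisj : (S : Set ℤ).PairwiseDisjoint (fun k => Ioc (a k) (b k)))
    (hcov : K ⊆ ⋃ k ∈ S, Icc (a k) (b k))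
    (hvol : volume ((⋃ k ∈ S, Ioc (a k) (b k)) \ K) ≤ ENNReal.ofReal ε) :
    |∑ k ∈ S, (F (b k) - F (a k)) - ∫ x in K, deriv F x| ≤ L * ε := by
  set V : Set ℝ := ⋃ k ∈ S, Ioc (a k) (b k) with hV
  have hint : ∀ k, IntegrableOn (deriv F) (Ioc (a k) (b k)) := fun k =>
    (hF.locallyIntegrable_deriv.integrableOn_isCompact isCompact_Icc).mono_set Ioc_subset_Icc_self
  have hsum : ∑ k ∈ S, (F (b k) - F (a k)) = ∫ x in V, deriv F x := by
    rw [hV, integral_biUnion_finset S (fun _ _ => measurableSet_Ioc) hdisj fun k _ => hint k]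
    exact Finset.sum_congr rfl fun k hk => (hF.setIntegral_Ioc_deriv (hab k hk)).symm
  have hVint : IntegrableOn (deriv F) V := (integrableOn_finset_iUnion).2 fun k _ => hint k
  have hKV : volume (K \ V) = 0 := by
    refine measure_mono_null (t := ⋃ k ∈ S, {a k}) ?_ ?_
    · rintro x ⟨hx, hxV⟩
      obtain ⟨k, hk, hxk⟩ := mem_iUnion₂.1 (hcov hx)
      refine mem_iUnion₂.2 ⟨k, hk, ?_⟩
      by_contra hne
      exact hxV (mem_iUnion₂.2 ⟨k, hk, lt_of_le_of_ne hxk.1 fun h => hne h.symm, hxk.2⟩)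
    · exact (Set.Finite.biUnion S.finite_toSet fun _ _ => finite_singleton _).measure_zero _
  have hKint : ∫ x in K, deriv F x = ∫ x in V ∩ K, deriv F x := by
    refine setIntegral_congr_set ?_
    rw [inter_comm, ← sdiff_sdiff_right_self]
    exact (sdiff_null_ae_eq_self hKV).symm
  rw [hsum, hKint, ← integral_inter_add_sdiff hK.measurableSet hVint, add_sub_cancel_left]
  exact hF.abs_setIntegral_deriv_le hε hvol

/-- Isolated points, where curve-flatness says nothing about the derivative, are isolated from the
right, and those are countably many. -/
theorem Set.countable_setOf_nhdsWithin_sdiff_singleton_eq_bot (K : Set ℝ) :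
    {x ∈ K | 𝓝[K \ {x}] x = ⊥}.Countable := by
  refine (countable_setOfPred_isolated_right_within (s := K)).mono ?_
  rintro x ⟨hxK, hx⟩
  refine ⟨hxK, ?_⟩
  have hle : 𝓝[K ∩ Ioi x] x ≤ 𝓝[K \ {x}] x :=
    nhdsWithin_mono x fun y hy => ⟨hy.1, ne_of_gt hy.2⟩
  exact le_bot_iff.1 (hle.trans_eq hx)

theorem tendsto_abs_slope_of_hasDerivAt_zero {F : ℝ → ℝ} {x F' : ℝ} (h : HasDerivAt F F' x)
    (s : Set ℝ) : Tendsto (fun y => |F x - F y| / |x - y|) (𝓝[s \ {x}] x) (𝓝 |F'|) := by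
  have h1 := (hasDerivAt_iff_tendsto_slope.1 h).mono_left
    (nhdsWithin_mono x (t := {x}ᶜ) fun y (hy : y ∈ s \ {x}) => hy.2)
  refine h1.abs.congr fun y => ?_
  rw [slope_def_field, abs_div, abs_sub_comm (F y), abs_sub_comm y]

theorem LipZero.lipschitzWith {M : Type*} [MetricSpace M] {o : M} (f : LipZero o) :
    LipschitzWith ‖f‖₊ (f : M → ℝ) :=
  LipschitzWith.of_dist_le_mul fun x y => by
    rw [Real.dist_eq]; exact LipZero.abs_sub_le f x y

/-! ### Curve-flatness as the vanishing of elements of the free space -/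

/-- The Riemann-type sums `m n` see only values of `f ∘ γ` on `K`, so one `μ` serves every Lipschitz
extension `F`. -/
theorem exists_mem_lipschitzFree_eq_setIntegral_deriv {M : Type*} [MetricSpace M] (o : M)
    {K : Set ℝ} (hK : IsCompact K) {γ : ℝ → M} {C : ℝ≥0} (hγ : LipschitzOnWith C γ K) :
    ∃ μ : lipschitzFree o, ∀ (f : LipZero o) (F : ℝ → ℝ) (L : ℝ≥0), LipschitzWith L F →
      EqOn F (fun t => f (γ t)) K → (μ : StrongDual ℝ (LipZero o)) f = ∫ x in K, deriv F x := by
  obtain ⟨u, -, hu0, hulim⟩ := exists_seq_strictAnti_tendsto (0 : ℝ)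
  choose S a b hab hdisj hcov hvol using fun n => hK.exists_finset_Icc_cover (hu0 n)
  let m : ℕ → StrongDual ℝ (LipZero o) := fun n =>
    ∑ k ∈ S n, (LipZero.delta o (γ (b n k)) - LipZero.delta o (γ (a n k)))
  have hm_apply : ∀ n (f : LipZero o),
      m n f = ∑ k ∈ S n, (f (γ (b n k)) - f (γ (a n k))) := fun n f => by
    simp only [m, sum_apply, sub_apply]
    rfl
  have hm_mem : ∀ n, m n ∈ lipschitzFree o := fun n =>
    Submodule.le_topologicalClosure _ <| Submodule.sum_mem _ fun k _ =>
      Submodule.sub_mem _ (Submodule.subset_span (mem_range_self _))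
        (Submodule.subset_span (mem_range_self _))
  have hbound : ∀ n (f : LipZero o) (F : ℝ → ℝ) (L : ℝ≥0), LipschitzWith L F →
      EqOn F (fun t => f (γ t)) K → |m n f - ∫ x in K, deriv F x| ≤ L * u n := by
    intro n f F L hF hFf
    have hsum : m n f = ∑ k ∈ S n, (F (b n k) - F (a n k)) :=
      (hm_apply n f).trans <| Finset.sum_congr rfl fun k hk =>
        (congrArg₂ (· - ·) (hFf (hab n k hk).2.1) (hFf (hab n k hk).1)).symm
    rw [hsum]
    exact hF.abs_sum_sub_setIntegral_deriv_le hK (hu0 n).le (fun k hk => (hab n k hk).2.2.1)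
      (hdisj n) (hcov n) (hvol n)
  -- An extension of `f ∘ γ` with constant `‖f‖ * C` makes the error linear in `‖f‖`, hence an
  -- operator norm bound.
  have hdist : ∀ n k, dist (m n) (m k) ≤ C * (u n + u k) := by
    intro n k
    rw [dist_eq_norm]
    have := (hu0 n).le
    have := (hu0 k).le
    refine ContinuousLinearMap.opNorm_le_bound _ (by positivity) fun f => ?_
    obtain ⟨F, hF, hFf⟩ :=
      ((f.lipschitzWith.comp_lipschitzOnWith hγ) : LipschitzOnWith _ _ _).extend_real
    have h1 := hbound n f F _ hF fun x hx => (hFf hx).symm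
    have h2 := hbound k f F _ hF fun x hx => (hFf hx).symm
    rw [NNReal.coe_mul, coe_nnnorm] at h1 h2
    rw [sub_apply, Real.norm_eq_abs]
    rw [abs_le] at *
    constructor <;> linarith [h1.1, h1.2, h2.1, h2.2]
  have hcauchy : CauchySeq m := by
    refine Metric.cauchySeq_iff.2 fun ε hε => ?_
    have hlim : Tendsto (fun n => C * u n) atTop (𝓝 0) := by simpa using hulim.const_mul (C : ℝ)
    obtain ⟨N, hN⟩ := eventually_atTop.1 (hlim.eventually_lt_const (half_pos hε))
    refine ⟨N, fun n hn k hk => (hdist n k).trans_lt ?_⟩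
    linarith [hN n hn, hN k hk]
  obtain ⟨μ, hμ⟩ := cauchySeq_tendsto_of_complete hcauchy
  refine ⟨⟨μ, (Submodule.isClosed_topologicalClosure _).mem_of_tendsto hμ
    (Eventually.of_forall hm_mem)⟩, fun f F L hF hFf => ?_⟩
  have h1 : Tendsto (fun n => m n f) atTop (𝓝 (μ f)) :=
    ((ContinuousLinearMap.apply ℝ ℝ f).continuous.tendsto μ).comp hμ
  refine tendsto_nhds_unique h1 (tendsto_iff_dist_tendsto_zero.2 ?_)
  have hlim : Tendsto (fun n => L * u n) atTop (𝓝 0) := by simpa using hulim.const_mul (L : ℝ)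
  exact squeeze_zero (fun _ => dist_nonneg) (fun n => hbound n f F L hF hFf) hlim

/-- At a non-isolated point of `K` where `F` is differentiable, the slopes along `K` alone determine
`|F'|`. -/
theorem IsCurveFlat.ae_deriv_eq_zero {M : Type*} [MetricSpace M] {f : M → ℝ} (hf : IsCurveFlat f)
    {K : Set ℝ} (hK : IsCompact K) {γ : ℝ → M} {C : ℝ≥0} (hγ : LipschitzOnWith C γ K)
    {F : ℝ → ℝ} {L : ℝ≥0} (hF : LipschitzWith L F) (hFf : EqOn F (fun t => f (γ t)) K) :
    ∀ᵐ x, x ∈ K → deriv F x = 0 := by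
  filter_upwards [hf.2 K γ hK ⟨C, hγ⟩, hF.ae_differentiableAt_real,
    (Set.countable_setOf_nhdsWithin_sdiff_singleton_eq_bot K).ae_notMem volume]
    with x hx hdiff hacc hxK
  have : (𝓝[K \ {x}] x).NeBot := ⟨fun h => hacc ⟨hxK, h⟩⟩
  have h2 : Tendsto (fun y => |F x - F y| / |x - y|) (𝓝[K \ {x}] x) (𝓝 0) := by
    refine (hx hxK).congr' ?_
    filter_upwards [self_mem_nhdsWithin] with y hy
    rw [Real.dist_eq, hFf hxK, hFf hy.1]
  exact abs_eq_zero.1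
    (tendsto_nhds_unique (tendsto_abs_slope_of_hasDerivAt_zero hdiff.hasDerivAt K) h2)

theorem isCurveFlat_of_forall_setIntegral_deriv_eq_zero {M : Type*} [MetricSpace M] {f : M → ℝ}
    {D : ℝ≥0} (hf : LipschitzWith D f)
    (h : ∀ (K : Set ℝ) (γ : ℝ → M) (C : ℝ≥0) (F : ℝ → ℝ) (L : ℝ≥0), IsCompact K →
      LipschitzOnWith C γ K → LipschitzWith L F → EqOn F (fun t => f (γ t)) K →
      ∫ x in K, deriv F x = 0) : IsCurveFlat f := by
  refine ⟨⟨D, hf⟩, fun K γ hK ⟨C, hγ⟩ => ?_⟩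
  obtain ⟨F, hF, hFf⟩ := ((hf.comp_lipschitzOnWith hγ) : LipschitzOnWith _ _ _).extend_real
  have hzero : K.indicator (deriv F) =ᵐ[volume] 0 := by
    refine ae_eq_zero_of_forall_setIntegral_isCompact_eq_zero
      ((hF.locallyIntegrable_deriv.integrableOn_isCompact hK).integrable_indicator
        hK.measurableSet) fun s hs => ?_
    rw [setIntegral_indicator hK.measurableSet]
    -- Restricting `γ` to all compact subsets of `K` upgrades a vanishing integral to `F' = 0`
    -- almost everywhere on `K`.
    exact h (s ∩ K) γ C F _ (hs.inter hK) (hγ.mono inter_subset_right) hF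
      fun x hx => (hFf hx.2).symm
  filter_upwards [hzero, hF.ae_differentiableAt_real] with x hx hdiff hxK
  rw [indicator_of_mem hxK] at hx
  have h1 := tendsto_abs_slope_of_hasDerivAt_zero hdiff.hasDerivAt K
  rw [hx, Pi.zero_apply, abs_zero] at h1
  refine h1.congr' ?_
  filter_upwards [self_mem_nhdsWithin] with y hy
  rw [Real.dist_eq, ← hFf hxK, ← hFf hy.1]
  rfl

theorem isClosed_curveFlatZero {M : Type*} [MetricSpace M] (o : M) :
    IsClosed[weakStarTopology o] (curveFlatZero o) := by
  let I := {q : Set ℝ × (ℝ → M) × ℝ≥0 // IsCompact q.1 ∧ LipschitzOnWith q.2.2 q.2.1 q.1}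
  choose μ hμ using fun q : I => exists_mem_lipschitzFree_eq_setIntegral_deriv o q.2.1 q.2.2
  have heq : curveFlatZero o =
      LipZero.toWeakDual ⁻¹' ⋂ q : I, {φ : WeakDual ℝ (lipschitzFree o) | φ (μ q) = 0} := by
    ext f
    simp only [mem_preimage, mem_iInter]
    constructor
    · intro hf q
      obtain ⟨F, hF, hFf⟩ :=
        ((f.lipschitzWith.comp_lipschitzOnWith q.2.2) : LipschitzOnWith _ _ _).extend_real
      have hFf' : EqOn F (fun t => f (q.1.2.1 t)) q.1.1 := fun x hx => (hFf hx).symm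
      refine (hμ q f F _ hF hFf').trans ?_
      exact setIntegral_eq_zero_of_ae_eq_zero (hf.ae_deriv_eq_zero q.2.1 q.2.2 hF hFf')
    · intro hf
      refine isCurveFlat_of_forall_setIntegral_deriv_eq_zero f.lipschitzWith
        fun K γ C F L hK hγ hF hFf => ?_
      exact (hμ ⟨(K, γ, C), hK, hγ⟩ f F L hF hFf).symm.trans (hf ⟨(K, γ, C), hK, hγ⟩)
  rw [heq]
  refine isClosed_induced (isClosed_iInter fun q => ?_)
  exact isClosed_singleton.preimage (WeakDual.eval_continuous (μ q))

/-! ### Null images when every Lipschitz function is curve-flat -/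

/-- Along `γ`, the distance to `γ x` has zero derivative almost everywhere on `K`, so it can grow
only across the gaps of `K`, at rate at most `C`. -/
theorem dist_le_of_forall_isCurveFlat {M : Type*} [MetricSpace M] {o : M}
    (h : ∀ f : LipZero o, IsCurveFlat (f : M → ℝ)) {K : Set ℝ} (hK : IsCompact K) {γ : ℝ → M}
    {C : ℝ≥0} (hγ : LipschitzOnWith C γ K) {x y : ℝ} (hx : x ∈ K) (hy : y ∈ K) (hxy : x ≤ y) :
    dist (γ x) (γ y) ≤ C * (volume (Ioc x y \ K)).toReal := by
  have hf1 : LipschitzWith 1 fun z => dist z (γ x) - dist o (γ x) :=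
    LipschitzWith.of_dist_le_mul fun z w => by
      rw [Real.dist_eq, sub_sub_sub_cancel_right, NNReal.coe_one, one_mul]
      exact abs_dist_sub_le z w (γ x)
  let f : LipZero o := ⟨fun z => dist z (γ x) - dist o (γ x), sub_self _, 1, hf1⟩
  obtain ⟨F, hF, hFf⟩ := ((hf1.comp_lipschitzOnWith hγ) : LipschitzOnWith _ _ _).extend_real
  have hfin : volume (Ioc x y \ K) ≠ ⊤ :=
    (measure_mono sdiff_subset).trans_lt measure_Ioc_lt_top |>.ne
  have hF0 := (h f).ae_deriv_eq_zero hK hγ hF fun t ht => (hFf ht).symm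
  have hdist : dist (γ x) (γ y) = F y - F x := by
    rw [← hFf hx, ← hFf hy]
    simp [dist_comm]
  have hint : IntegrableOn (deriv F) (Ioc x y) :=
    (hF.locallyIntegrable_deriv.integrableOn_isCompact isCompact_Icc).mono_set Ioc_subset_Icc_self
  rw [hdist, ← hF.setIntegral_Ioc_deriv hxy, ← integral_inter_add_sdiff hK.measurableSet hint,
    setIntegral_eq_zero_of_ae_eq_zero (hF0.mono fun t ht hts => ht hts.2), zero_add]
  refine (le_abs_self _).trans ?_
  have := hF.abs_setIntegral_deriv_le ENNReal.toReal_nonneg (ENNReal.ofReal_toReal hfin).ge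
  rwa [one_mul] at this

/-- Each piece of `γ '' K` has diameter at most `C` times the gap length in its interval; the gaps
are disjoint, so the diameters sum to at most `C * u n`. -/
theorem hausdorffMeasure_image_isCompact_eq_zero {M : Type*} [MetricSpace M] [MeasurableSpace M]
    [BorelSpace M] {o : M} (h : ∀ f : LipZero o, IsCurveFlat (f : M → ℝ)) {K : Set ℝ}
    (hK : IsCompact K) {γ : ℝ → M} {C : ℝ≥0} (hγ : LipschitzOnWith C γ K) :
    μH[1] (γ '' K) = 0 := by
  obtain ⟨u, -, hu0, hulim⟩ := exists_seq_strictAnti_tendsto (0 : ℝ)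
  choose S a b hab hdisj hcov hvol using fun n => hK.exists_finset_Icc_cover (hu0 n)
  let r : ℕ → ENNReal := fun n => C * ENNReal.ofReal (u n)
  have hr : Tendsto r atTop (𝓝 0) := by
    have h1 := ENNReal.Tendsto.const_mul (a := (C : ENNReal)) (ENNReal.tendsto_ofReal hulim)
      (Or.inr ENNReal.coe_ne_top)
    simpa using h1
  let t : ∀ n, S n → Set M := fun n k => γ '' (K ∩ Icc (a n k) (b n k))
  have hdiam : ∀ n (k : S n),
      Metric.ediam (t n k) ≤ C * volume (Ioc (a n k) (b n k) \ K) := by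
    intro n k
    refine Metric.ediam_le ?_
    rintro _ ⟨x, hx, rfl⟩ _ ⟨y, hy, rfl⟩
    wlog hxy : x ≤ y generalizing x y
    · rw [edist_comm]
      exact this y hy x hx (not_le.1 hxy).le
    have hfin : volume (Ioc x y \ K) ≠ ⊤ :=
      (measure_mono sdiff_subset).trans_lt measure_Ioc_lt_top |>.ne
    calc edist (γ x) (γ y) = ENNReal.ofReal (dist (γ x) (γ y)) := edist_dist _ _
      _ ≤ ENNReal.ofReal (C * (volume (Ioc x y \ K)).toReal) :=
        ENNReal.ofReal_le_ofReal (dist_le_of_forall_isCurveFlat h hK hγ hx.1 hy.1 hxy)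
      _ = C * volume (Ioc x y \ K) := by
        rw [ENNReal.ofReal_mul C.coe_nonneg, ENNReal.ofReal_toReal hfin, ENNReal.ofReal_coe_nnreal]
      _ ≤ C * volume (Ioc (a n k) (b n k) \ K) := by
        gcongr
        exacts [hx.2.1, hy.2.2]
  have hsum : ∀ n, ∑ k : S n, C * volume (Ioc (a n k) (b n k) \ K) ≤ r n := by
    intro n
    rw [← Finset.mul_sum,
      Finset.sum_coe_sort (S n) fun k => volume (Ioc (a n k) (b n k) \ K),
      ← measure_biUnion_finset ((hdisj n).mono_on fun k _ => sdiff_subset)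
        fun k _ => measurableSet_Ioc.diff hK.measurableSet]
    refine mul_le_mul_right ((measure_mono ?_).trans (hvol n)) _
    exact iUnion₂_subset fun k hk x hx => ⟨mem_iUnion₂.2 ⟨k, hk, hx.1⟩, hx.2⟩
  have hle := Measure.hausdorffMeasure_le_liminf_sum 1 (γ '' K) r hr t
    (Eventually.of_forall fun n k => (hdiam n k).trans <|
      (Finset.single_le_sum (f := fun k : S n => C * volume (Ioc (a n k) (b n k) \ K))
        (fun _ _ => zero_le) (Finset.mem_univ k)).trans (hsum n))
    (Eventually.of_forall fun n => by
      rintro _ ⟨x, hx, rfl⟩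
      obtain ⟨k, hk, hxk⟩ := mem_iUnion₂.1 (hcov n hx)
      exact mem_iUnion.2 ⟨⟨k, hk⟩, x, ⟨hx, hxk⟩, rfl⟩)
  refine le_antisymm (hle.trans ?_) zero_le
  rw [← hr.liminf_eq]
  refine liminf_le_liminf (Eventually.of_forall fun n => ?_)
  simp only [ENNReal.rpow_one]
  exact (Finset.sum_le_sum fun k _ => hdiam n k).trans (hsum n)

theorem isPurelyOneUnrectifiable_of_forall_isCurveFlat {M : Type*} [MetricSpace M]
    [MeasurableSpace M] [BorelSpace M] {o : M}
    (h : ∀ f : LipZero o, IsCurveFlat (f : M → ℝ)) : IsPurelyOneUnrectifiable M := by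
  rintro A γ hA ⟨C, hγ⟩
  have hAn : ∀ n : ℕ, μH[1] (γ '' (A ∩ Icc (-n) n)) = 0 := by
    intro n
    set B : Set ℝ := A ∩ Icc (-n) n with hB
    have hBm : MeasurableSet B := hA.inter measurableSet_Icc
    have hBfin : volume B ≠ ⊤ :=
      (measure_mono inter_subset_right).trans_lt measure_Icc_lt_top |>.ne
    have hγB : LipschitzOnWith C γ B := hγ.mono inter_subset_left
    -- Inner regularity leaves only the image of `B \ K`, controlled by the Lipschitz constant. For
    -- `m = 0` the tolerance is `⊤`, which is harmless.
    have hle : ∀ m : ℕ, μH[1] (γ '' B) ≤ C * (m : ENNReal)⁻¹ := by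
      intro m
      obtain ⟨K, hKB, hK, hvol⟩ :=
        hBm.exists_isCompact_sdiff_lt hBfin (ε := (m : ENNReal)⁻¹) (by simp)
      calc μH[1] (γ '' B) = μH[1] (γ '' K ∪ γ '' (B \ K)) := by
            rw [← image_union, union_sdiff_cancel hKB]
        _ ≤ μH[1] (γ '' K) + μH[1] (γ '' (B \ K)) := measure_union_le _ _
        _ = μH[1] (γ '' (B \ K)) := by
            rw [hausdorffMeasure_image_isCompact_eq_zero h hK (hγB.mono hKB), zero_add]
        _ ≤ C * volume (B \ K) := by
            simpa [hausdorffMeasure_real] using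
              (hγB.mono (sdiff_subset (t := K))).hausdorffMeasure_image_le zero_le_one
        _ ≤ C * (m : ENNReal)⁻¹ := by gcongr
    have hlim := ENNReal.Tendsto.const_mul (a := (C : ENNReal))
      ENNReal.tendsto_inv_nat_nhds_zero (Or.inr ENNReal.coe_ne_top)
    rw [mul_zero] at hlim
    exact le_antisymm (ge_of_tendsto' hlim hle) zero_le
  refine measure_mono_null ?_ (measure_iUnion_null hAn)
  rintro _ ⟨x, hx, rfl⟩
  obtain ⟨n, hn⟩ := exists_nat_ge |x|
  exact mem_iUnion.2 ⟨n, x, ⟨hx, abs_le.1 hn⟩, rfl⟩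

/-! ### Arbitrary sets in the complete case -/

/-- Uniformly continuous maps send Cauchy filters to Cauchy filters, so limits exist in `M`. This
replaces an arbitrary domain by a closed, hence Borel, one. -/
theorem LipschitzOnWith.exists_extend_closure {X M : Type*} [PseudoMetricSpace X] [MetricSpace M]
    [CompleteSpace M] {A : Set X} {γ : X → M} {C : ℝ≥0} (hγ : LipschitzOnWith C γ A) :
    ∃ g : X → M, LipschitzOnWith C g (closure A) ∧ EqOn g γ A := by
  rcases A.eq_empty_or_nonempty with rfl | ⟨x₀, -⟩
  · exact ⟨γ, by simp, fun _ h => h.elim⟩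
  have : Nonempty M := ⟨γ x₀⟩
  have hg : EqOn (extendFrom A γ) γ A := fun x hx =>
    extendFrom_eq (subset_closure hx) (hγ.continuousOn x hx)
  refine ⟨extendFrom A γ, ?_, hg⟩
  refine LipschitzOnWith.closure (continuousOn_extendFrom subset_rfl fun x hx => ?_) ?_
  · have : (𝓝[A] x).NeBot := mem_closure_iff_nhdsWithin_neBot.1 hx
    refine CompleteSpace.complete ((cauchy_nhds.mono nhdsWithin_le_nhds).map_of_le
      hγ.uniformContinuousOn ?_)
    exact le_principal_iff.2 self_mem_nhdsWithin
  · intro x hx y hy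
    rw [hg hx, hg hy]
    exact hγ hx hy

theorem propositionp {M : Type*} [MetricSpace M] [MeasurableSpace M] [BorelSpace M] (o : M) :
    IsClosed[weakStarTopology o] (curveFlatZero o) ∧
    (@Dense (LipZero o) (weakStarTopology o) (curveFlatZero o) → IsPurelyOneUnrectifiable M) ∧
    (CompleteSpace M → @Dense (LipZero o) (weakStarTopology o) (curveFlatZero o) →
      IsStronglyPurelyOneUnrectifiable M) := by
  have hpure (hd : @Dense (LipZero o) (weakStarTopology o) (curveFlatZero o)) :
      IsPurelyOneUnrectifiable M := by
    refine isPurelyOneUnrectifiable_of_forall_isCurveFlat (o := o) fun f => ?_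
    have hf := @Dense.closure_eq _ (weakStarTopology o) _ hd
    rw [@IsClosed.closure_eq _ (weakStarTopology o) _ (isClosed_curveFlatZero o)] at hf
    have hmem : f ∈ curveFlatZero o := hf ▸ mem_univ f
    exact hmem
  refine ⟨isClosed_curveFlatZero o, hpure, fun _ hd A γ ⟨C, hγ⟩ => ?_⟩
  obtain ⟨g, hg, hgγ⟩ := hγ.exists_extend_closure
  refine measure_mono_null ?_ (hpure hd (closure A) g isClosed_closure.measurableSet ⟨C, hg⟩)
  rw [← hgγ.image_eq]
  exact image_mono subset_closure
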